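/- Let $(\Omega,\mathcal F,\mathbb P)$ be a probability space. Random variables $X_1,\dots,X_n$ form a \emph{swap-invariant} vector under $\mathbb P$ if they are integrable and $\mathbb E_{\mathbb P}\bigl|\sum_{i=1}^n u_iX_{\pi(i)}\bigr|=\mathbb E_{\mathbb P}\bigl|\sum_{i=1}^n u_iX_i\bigr|$ for all $u\in\mathbb R^n$ and all permutations $\pi$ of $\{1,\dots,n\}$. A random sequence $\xi=(\xi_j)_{j\ge1}$ of real random variables is swap-invariant (respectively exchangeable) if each vector $(\xi_{k_1},\dots,\xi_{k_n})$ with distinct indices is swap-invariant (respectively has a law invariant under permutations of its coordinates); it is symmetric if $-\xi$ and $\xi$ have the same law. For $x\in\mathbb R^{\infty}$ and $n\ge1$ put $$\|x\|_p^{(n)}=\Bigl(n^{-1}\sum_{j=1}^n|x_j|^p\Bigr)^{1/p}\quad(1\le p<\infty),\qquad \|x\|_\infty^{(n)}=\max_{1\le j\le n}|x_j|,\qquad \|x\|_p=\limsup_{n\to\infty}\|x\|_p^{(n)}\in[0,\infty].$$ \textbf{Theorem.} Fix $p\in[1,\infty]$. Let $\xi$ be a random sequence that is swap-invariant under $\mathbb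 P$ and such that $\|\xi\|_p^{(n)}\to\|\xi\|_p$ as $n\to\infty$, $\mathbb P$-almost surely and in $L^1(\mathbb P)$, and $\mathbb E_{\mathbb P}\|\xi\|_p>0$. Then $$\frac{d\mathbb Q}{d\mathbb P}=\frac{\|\xi\|_p}{\mathbb E_{\mathbb P}\|\xi\|_p}$$ defines a probability measure $\mathbb Q$, and the following hold. (i) Let $\varepsilon$ be a random variable on $(\Omega,\mathcal F,\mathbb P)$ that takes the values $\pm1$ with probability $1/2$ each and is independent of $\xi$ under $\mathbb P$. Then there exists a random sequence $\zeta$ on $\Omega$ that is exchangeable under $\mathbb Q$ such that $\varepsilon\,\xi_j=\|\xi\|_p\,\zeta_j$ $\mathbb P$-almost surely for every $j\ge1$. (ii) If $\xi$ is symmetric under $\mathbb P$, or if $\xi$ is non-negative ($\xi_j\ge0$ $\mathbb P$-almost surely for every $j\ge1$), then there exists a random sequence $\eta$ on $\Omega$ that is exchangeable under $\mathbb Q$ such that $\xi_j=\|\xi\|_p\,\eta_j$ $\mathbb P$-almost surely for every $j\ge1$. -/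

import Mathlib

open MeasureTheory ProbabilityTheory Filter Topology
open scoped ENNReal

section SwapInvariance

variable {Ω : Type*} [MeasurableSpace Ω]

/-- Two random vectors, indexed by a finite type, are zonoid equivalent under `P`: both are
integrable, and `E |⟨u, X⟩| = E |⟨u, Y⟩|` for every vector `u`. -/
structure ZonoidEquivalent {ι : Type*} [Fintype ι] (X Y : ι → Ω → ℝ) (P : Measure Ω) : Prop where
  integrable_left : ∀ i, Integrable (X i) P
  integrable_right : ∀ i, Integrable (Y i) P
  integral_eq : ∀ u : ι → ℝ, ∫ ω, |∑ i, u i * X i ω| ∂P = ∫ ω, |∑ i, u i * Y i ω| ∂P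

/-- A random vector is swap-invariant if each of its permutations is zonoid equivalent to it. -/
def SwapInvariantVector {ι : Type*} [Fintype ι] (X : ι → Ω → ℝ) (P : Measure Ω) : Prop :=
  ∀ σ : Equiv.Perm ι, ZonoidEquivalent (fun i => X (σ i)) X P

/-- A random vector is exchangeable if each of its permutations has the same law. -/
def ExchangeableVector {ι : Type*} [Fintype ι] (X : ι → Ω → ℝ) (P : Measure Ω) : Prop :=
  ∀ σ : Equiv.Perm ι, IdentDistrib (fun ω i => X (σ i) ω) (fun ω i => X i ω) P P

/-- A random sequence is swap-invariant if all its finite subvectors (with distinct indices)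
are swap-invariant. -/
def SwapInvariant (ξ : ℕ → Ω → ℝ) (P : Measure Ω) : Prop :=
  ∀ (n : ℕ) (k : Fin n ↪ ℕ), SwapInvariantVector (fun i => ξ (k i)) P

/-- A random sequence is exchangeable if all its finite subvectors (with distinct indices)
are exchangeable. -/
def Exchangeable (ξ : ℕ → Ω → ℝ) (P : Measure Ω) : Prop :=
  ∀ (n : ℕ) (k : Fin n ↪ ℕ), ExchangeableVector (fun i => ξ (k i)) P

/-- A random sequence is symmetric if `-ξ` and `ξ` have the same law on `ℝ^ℕ`. -/
def SymmetricSequence (ξ : ℕ → Ω → ℝ) (P : Measure Ω) : Prop :=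
  IdentDistrib (fun ω j => -ξ j ω) (fun ω j => ξ j ω) P P

end SwapInvariance

/-- The normalized `p`-norm of the first `n` members `x 0, …, x (n - 1)` of a sequence:
`(n⁻¹ ∑ |x j| ^ p) ^ (1 / p)` for `p < ∞`, and `max |x j|` for `p = ∞`. -/
noncomputable def meanNorm (p : ℝ≥0∞) (n : ℕ) (x : ℕ → ℝ) : ℝ≥0∞ :=
  if p = ∞ then ⨆ j ∈ Finset.range n, ENNReal.ofReal |x j|
  else ((n : ℝ≥0∞)⁻¹ * ∑ j ∈ Finset.range n, ENNReal.ofReal |x j| ^ p.toReal) ^ (1 / p.toReal)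

/-- The upper limit of the normalized `p`-norms, an element of `[0, ∞]`. -/
noncomputable def limNorm (p : ℝ≥0∞) (x : ℕ → ℝ) : ℝ≥0∞ :=
  limsup (fun n => meanNorm p n x) atTop

/-- The distance `|a - b|` in `[0, ∞]`; subtraction there is truncated, so that one of the two
summands is zero, and the value is `∞` if exactly one of `a`, `b` is `∞`. -/
noncomputable def absDiff (a b : ℝ≥0∞) : ℝ≥0∞ := (a - b) + (b - a)

/-- The measure whose density with respect to `P` is `‖ξ‖_p / E ‖ξ‖_p`. -/
noncomputable def normTilted {Ω : Type*} [MeasurableSpace Ω] (p : ℝ≥0∞) (ξ : ℕ → Ω → ℝ)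
    (P : Measure Ω) : Measure Ω :=
  P.withDensity fun ω =>
    limNorm p (fun j => ξ j ω) / ∫⁻ ω', limNorm p (fun j => ξ j ω') ∂P

/-! Zonoid equivalence determines `E f(X)` for every even, positively homogeneous `f ≥ 0`, not only
for `|⟨u, x⟩|` (`lintegral_eq_of_zonoidEquivalent`). Indeed, under the density `|X i|` the numbers
`E |⟨u, X⟩ - a * X i|` are, up to a constant, the absolute potential of `⟨u, X / X i⟩`, so by
Cramér–Wold they fix the law of the ratios `X / X i`. With `N` the norm of the first `n` members and
`F` even, apply this to `F(x_k / N) * N`: permuting the selected indices leaves `N` unchanged, hence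
also the mean. The convergence of the norms carries this over to the limit norm `L`, so under `Q`
even bounded continuous functions of finitely many coordinates of `ξ / L` have permutation-invariant
means (`lintegral_even_mul_lim_perm`). Evenness is no restriction once the law is symmetrized by
`ε`, is already symmetric, or lives on non-negative vectors. The factorization also requires `ξ j =
0` where `L = 0` (`eq_zero_of_lim_eq_zero`). The means of `|ξ j|` over that event do not depend on
`j`, and their averages are at most `E |N - L|`, which tends to zero. -/

/-! ### Absolute potentials on the line -/

/-- The right derivative of `|x - a|` in `a` is `1` for `x ≤ a` and `-1` for `x > a`; difference
quotients are bounded by `1`, so dominated convergence recovers the distribution function. -/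
theorem tendsto_mul_integral_abs_sub (μ : Measure ℝ) [IsFiniteMeasure μ]
    (hμ : Integrable (fun x => x) μ) (a : ℝ) :
    Tendsto (fun n : ℕ => ((n : ℝ) + 1) *
      (∫ x, |x - a| ∂μ - ∫ x, |x - (a + 1 / ((n : ℝ) + 1))| ∂μ)) atTop
      (𝓝 (μ.real Set.univ - 2 * μ.real (Set.Iic a))) := by
  have hint : ∀ b : ℝ, Integrable (fun x => |x - b|) μ := fun b =>
    (hμ.sub (integrable_const b)).abs
  have hlim : μ.real Set.univ - 2 * μ.real (Set.Iic a)
      = ∫ x, (1 - 2 * (Set.Iic a).indicator (fun _ => (1 : ℝ)) x) ∂μ := by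
    rw [integral_sub (integrable_const _)
      (((integrable_const _).indicator measurableSet_Iic).const_mul _), integral_const_mul,
      integral_indicator_const _ measurableSet_Iic]
    simp
  have hseq : ∀ n : ℕ, ((n : ℝ) + 1) *
      (∫ x, |x - a| ∂μ - ∫ x, |x - (a + 1 / ((n : ℝ) + 1))| ∂μ)
      = ∫ x, ((n : ℝ) + 1) * (|x - a| - |x - (a + 1 / ((n : ℝ) + 1))|) ∂μ := by
    intro n
    rw [integral_const_mul, integral_sub (hint _) (hint _)]
  rw [hlim]
  simp_rw [hseq]
  refine tendsto_integral_of_dominated_convergence (fun _ => (1 : ℝ)) ?_ (integrable_const _) ?_ ?_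
  · intro n
    exact (((hint _).sub (hint _)).const_mul _).aestronglyMeasurable
  · intro n
    refine Eventually.of_forall fun x => ?_
    have hn : (0 : ℝ) < (n : ℝ) + 1 := by positivity
    rw [Real.norm_eq_abs, abs_mul, abs_of_pos hn]
    have h1 := abs_abs_sub_abs_le (x - a) (x - (a + 1 / ((n : ℝ) + 1)))
    have h2 : (x - a) - (x - (a + 1 / ((n : ℝ) + 1))) = 1 / ((n : ℝ) + 1) := by ring
    rw [h2, abs_of_pos (one_div_pos.2 hn)] at h1
    calc _ ≤ ((n : ℝ) + 1) * (1 / ((n : ℝ) + 1)) := mul_le_mul_of_nonneg_left h1 hn.le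
      _ = 1 := by field_simp
  · refine Eventually.of_forall fun x => ?_
    by_cases hx : x ≤ a
    · have : ∀ n : ℕ, ((n : ℝ) + 1) * (|x - a| - |x - (a + 1 / ((n : ℝ) + 1))|)
          = 1 - 2 * (Set.Iic a).indicator (fun _ => (1 : ℝ)) x := by
        intro n
        have hn : (0 : ℝ) < 1 / ((n : ℝ) + 1) := by positivity
        rw [abs_of_nonpos (by linarith), abs_of_nonpos (by linarith),
          Set.indicator_of_mem (by simpa using hx)]
        field_simp
        ring
      simp_rw [this]
      exact tendsto_const_nhds
    · push Not at hx
      refine tendsto_const_nhds.congr' ?_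
      have hev : ∀ᶠ n : ℕ in atTop, 1 / ((n : ℝ) + 1) < x - a :=
        tendsto_one_div_add_atTop_nhds_zero_nat.eventually (gt_mem_nhds (by linarith))
      filter_upwards [hev] with n hn
      rw [abs_of_nonneg (by linarith), abs_of_nonneg (by linarith),
        Set.indicator_of_notMem (by simpa using hx)]
      field_simp
      ring

/-- A finite measure on the line is determined by its mass and, up to an additive constant, by
its absolute potential. -/
theorem ext_of_integral_abs_sub {μ ν : Measure ℝ} [IsFiniteMeasure μ] [IsFiniteMeasure ν]
    (hμ : Integrable (fun x => x) μ) (hν : Integrable (fun x => x) ν)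
    (hmass : μ Set.univ = ν Set.univ) (C : ℝ)
    (h : ∀ a, ∫ x, |x - a| ∂μ = ∫ x, |x - a| ∂ν + C) : μ = ν := by
  refine Measure.ext_of_Iic _ _ fun a => ?_
  have h1 := tendsto_mul_integral_abs_sub μ hμ a
  have h2 := tendsto_mul_integral_abs_sub ν hν a
  -- The constant `C` cancels in the difference quotient.
  simp_rw [h, add_sub_add_right_eq_sub] at h1
  have h3 := tendsto_nhds_unique h1 h2
  have hm : μ.real Set.univ = ν.real Set.univ := by simp [Measure.real, hmass]
  have h4 : μ.real (Set.Iic a) = ν.real (Set.Iic a) := by linarith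
  exact (measureReal_eq_measureReal_iff).1 h4

/-! ### Zonoid equivalence and even homogeneous functions -/

section Ratio

variable {Ω ι : Type*} [MeasurableSpace Ω]

/-- The finite measure with density `|X i|`. -/
noncomputable def absWeighted (X : ι → Ω → ℝ) (P : Measure Ω) (i : ι) : Measure Ω :=
  P.withDensity fun ω => (‖X i ω‖₊ : ℝ≥0∞)

/-- The law of the ratios `X / X i` under the measure with density `|X i|`. -/
noncomputable def ratioLaw (X : ι → Ω → ℝ) (P : Measure Ω) (i : ι) : Measure (ι → ℝ) :=
  (absWeighted X P i).map fun ω j => X j ω / X i ω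

theorem isFiniteMeasure_absWeighted {X : ι → Ω → ℝ} {P : Measure Ω} {i : ι}
    (hX : Integrable (X i) P) : IsFiniteMeasure (absWeighted X P i) :=
  isFiniteMeasure_withDensity hX.hasFiniteIntegral.ne

/-- Homogeneity gives `f(X) = |X i| * f(X / X i)` off `{X i = 0}`, where the density vanishes. -/
theorem lintegral_eq_lintegral_ratioLaw {X : ι → Ω → ℝ} {P : Measure Ω}
    (hm : ∀ i, Measurable (X i)) {f : (ι → ℝ) → ℝ≥0∞} (hf : Measurable f)
    (hh : ∀ (c : ℝ) (x : ι → ℝ), f (c • x) = ENNReal.ofReal |c| * f x) (i : ι) :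
    ∫⁻ ω, {x : ι → ℝ | x i ≠ 0}.indicator f (fun j => X j ω) ∂P
      = ∫⁻ x, f x ∂(ratioLaw X P i) := by
  have hr : Measurable fun ω j => X j ω / X i ω := by fun_prop
  rw [ratioLaw, lintegral_map hf hr, absWeighted,
    lintegral_withDensity_eq_lintegral_mul _ (by fun_prop)
      (show Measurable fun ω => f fun j => X j ω / X i ω from hf.comp hr)]
  refine lintegral_congr fun ω => ?_
  by_cases h : X i ω = 0
  · simp [h]
  · simp only [Set.indicator, Set.mem_ofPred_eq, ne_eq, h, not_false_eq_true, if_true,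
      Pi.mul_apply, ← enorm_eq_nnnorm, Real.enorm_eq_ofReal_abs]
    rw [← hh]
    congr 1
    ext j
    simp only [Pi.smul_apply, smul_eq_mul]
    field_simp

variable [Fintype ι]

/-- The weight `|X i|` clears the denominator. The correction on `{X i = 0}` is free of `a`, so it
only shifts the potential by a constant. -/
theorem integral_abs_ratio {X : ι → Ω → ℝ} {P : Measure Ω} (hm : ∀ i, Measurable (X i))
    (hX : ∀ i, Integrable (X i) P) (i : ι) (u : ι → ℝ) (a : ℝ) :
    ∫ ω, |∑ j, u j * (X j ω / X i ω) - a| ∂(absWeighted X P i) =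
      ∫ ω, |∑ j, u j * X j ω - a * X i ω| ∂P
        - ∫ ω, {ω | X i ω = 0}.indicator (fun ω => |∑ j, u j * X j ω|) ω ∂P := by
  have hms : MeasurableSet {ω | X i ω = 0} := hm i (measurableSet_singleton 0)
  have hs : Integrable (fun ω => ∑ j, u j * X j ω) P :=
    integrable_finsetSum _ fun j _ => (hX j).const_mul _
  rw [absWeighted, integral_withDensity_eq_integral_smul (hm i).nnnorm,
    ← integral_sub (f := fun ω => |∑ j, u j * X j ω - a * X i ω|)
      (hs.sub ((hX i).const_mul a)).abs (hs.abs.indicator hms)]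
  refine integral_congr_ae (Eventually.of_forall fun ω => ?_)
  by_cases h : X i ω = 0
  · simp [h]
  · simp only [NNReal.smul_def, coe_nnnorm, Real.norm_eq_abs, smul_eq_mul, Set.indicator,
      Set.mem_ofPred_eq, h, if_false, sub_zero, ← abs_mul]
    congr 1
    rw [mul_sub, Finset.mul_sum, mul_comm a]
    congr 1
    refine Finset.sum_congr rfl fun j _ => ?_
    field_simp

theorem integrable_ratio {X : ι → Ω → ℝ} {P : Measure Ω} (hm : ∀ i, Measurable (X i))
    (hX : ∀ i, Integrable (X i) P) (i : ι) (u : ι → ℝ) :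
    Integrable (fun ω => ∑ j, u j * (X j ω / X i ω)) (absWeighted X P i) := by
  refine integrable_finsetSum _ fun j _ => Integrable.const_mul ?_ _
  rw [absWeighted, integrable_withDensity_iff_integrable_smul (hm i).nnnorm]
  refine (hX j).abs.mono' (by fun_prop) (Eventually.of_forall fun ω => ?_)
  by_cases h : X i ω = 0
  · simp [h]
  · simp only [NNReal.smul_def, coe_nnnorm, Real.norm_eq_abs, smul_eq_mul, abs_mul, abs_abs,
      abs_div]
    rw [mul_div_cancel₀ _ (abs_ne_zero.2 h)]

theorem ratioLaw_eq_of_zonoidEquivalent {X Y : ι → Ω → ℝ} {P : Measure Ω}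
    (hmX : ∀ i, Measurable (X i)) (hmY : ∀ i, Measurable (Y i)) (h : ZonoidEquivalent X Y P)
    (i : ι) : ratioLaw X P i = ratioLaw Y P i := by
  classical
  obtain ⟨hX, hY, he⟩ := h
  have hfX := isFiniteMeasure_absWeighted (hX i)
  have hfY := isFiniteMeasure_absWeighted (hY i)
  have hrX : Measurable fun ω j => X j ω / X i ω := by fun_prop
  have hrY : Measurable fun ω j => Y j ω / Y i ω := by fun_prop
  have hi : IsFiniteMeasure (ratioLaw X P i) := Measure.isFiniteMeasure_map _ _
  have hj : IsFiniteMeasure (ratioLaw Y P i) := Measure.isFiniteMeasure_map _ _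
  have hmass : absWeighted X P i Set.univ = absWeighted Y P i Set.univ := by
    have h1 := he (Pi.single i 1)
    simp only [Pi.single_apply, ite_mul, one_mul, zero_mul, Finset.sum_ite_eq',
      Finset.mem_univ, if_true] at h1
    have e1 := ofReal_integral_norm_eq_lintegral_enorm (hX i)
    have e2 := ofReal_integral_norm_eq_lintegral_enorm (hY i)
    simp only [Real.norm_eq_abs] at e1 e2
    rw [h1, e2] at e1
    simpa [absWeighted, enorm_eq_nnnorm] using e1.symm
  -- Cramér–Wold: it suffices to compare the images under each linear functional `L`.
  refine Measure.ext_of_charFunDual (funext fun L => ?_)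
  rw [charFunDual_eq_charFun_map_one, charFunDual_eq_charFun_map_one]
  congr 1
  have hL : ∀ x : ι → ℝ, L x = ∑ j, L (Pi.single j 1) * x j := by
    intro x
    have := L.toLinearMap.pi_apply_eq_sum_univ x
    simp only [ContinuousLinearMap.coe_coe, smul_eq_mul] at this
    rw [this]
    refine Finset.sum_congr rfl fun j _ => ?_
    rw [mul_comm]
    congr 2
    ext k
    simp [Pi.single_apply, eq_comm]
  set u : ι → ℝ := fun j => L (Pi.single j 1) with hu
  have hcX : (ratioLaw X P i).map L
      = (absWeighted X P i).map fun ω => ∑ j, u j * (X j ω / X i ω) := by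
    rw [ratioLaw, Measure.map_map (by fun_prop) hrX]
    congr 1
    ext ω
    exact hL _
  have hcY : (ratioLaw Y P i).map L
      = (absWeighted Y P i).map fun ω => ∑ j, u j * (Y j ω / Y i ω) := by
    rw [ratioLaw, Measure.map_map (by fun_prop) hrY]
    congr 1
    ext ω
    exact hL _
  have hVX : Measurable fun ω => ∑ j, u j * (X j ω / X i ω) := by fun_prop
  have hVY : Measurable fun ω => ∑ j, u j * (Y j ω / Y i ω) := by fun_prop
  rw [hcX, hcY]
  have hi := Measure.isFiniteMeasure_map (absWeighted X P i)
    fun ω => ∑ j, u j * (X j ω / X i ω)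
  have hj := Measure.isFiniteMeasure_map (absWeighted Y P i)
    fun ω => ∑ j, u j * (Y j ω / Y i ω)
  refine ext_of_integral_abs_sub ?_ ?_ ?_
    (∫ ω, {ω | Y i ω = 0}.indicator (fun ω => |∑ j, u j * Y j ω|) ω ∂P
      - ∫ ω, {ω | X i ω = 0}.indicator (fun ω => |∑ j, u j * X j ω|) ω ∂P) ?_
  · rw [integrable_map_measure (by fun_prop) hVX.aemeasurable]
    exact integrable_ratio hmX hX i u
  · rw [integrable_map_measure (by fun_prop) hVY.aemeasurable]
    exact integrable_ratio hmY hY i u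
  · rw [Measure.map_apply hVX .univ, Measure.map_apply hVY .univ]
    simpa using hmass
  · intro a
    rw [integral_map hVX.aemeasurable (by fun_prop), integral_map hVY.aemeasurable (by fun_prop),
      integral_abs_ratio hmX hX, integral_abs_ratio hmY hY]
    -- Testing with `u - a e_i` turns the shift by `a` of the ratio into a linear form in the
    -- vector.
    have h1 := he (u - (Pi.single i a : ι → ℝ))
    have h2 : ∀ Z : ι → Ω → ℝ, ∀ ω, ∑ j, (u - (Pi.single i a : ι → ℝ)) j * Z j ω
        = ∑ j, u j * Z j ω - a * Z i ω := by
      intro Z ω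
      simp [sub_mul, Finset.sum_sub_distrib, Pi.single_apply]
    simp_rw [h2] at h1
    linarith

/-- Zonoid equivalent vectors give the same mean to every non-negative, even, homogeneous
function. -/
theorem lintegral_eq_of_zonoidEquivalent {X Y : ι → Ω → ℝ} {P : Measure Ω}
    (hmX : ∀ i, Measurable (X i)) (hmY : ∀ i, Measurable (Y i)) (h : ZonoidEquivalent X Y P)
    {f : (ι → ℝ) → ℝ≥0∞} (hf : Measurable f)
    (hh : ∀ (c : ℝ) (x : ι → ℝ), f (c • x) = ENNReal.ofReal |c| * f x) :
    ∫⁻ ω, f (fun j => X j ω) ∂P = ∫⁻ ω, f (fun j => Y j ω) ∂P := by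
  classical
  -- Adding `i` to `s` adds the piece where `x i ≠ 0` and all coordinates in `s` vanish. This set is
  -- a cone, so `f` restricted to it is still homogeneous and the ratio law at `i` applies.
  have key : ∀ s : Finset ι,
      ∫⁻ ω, {x : ι → ℝ | ∃ i ∈ s, x i ≠ 0}.indicator f (fun j => X j ω) ∂P
        = ∫⁻ ω, {x : ι → ℝ | ∃ i ∈ s, x i ≠ 0}.indicator f (fun j => Y j ω) ∂P := by
    intro s
    induction s using Finset.induction_on with
    | empty => simp
    | insert i s _ ih =>
      set g : (ι → ℝ) → ℝ≥0∞ := {x : ι → ℝ | ∀ k ∈ s, x k = 0}.indicator f with hg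
      have hms : MeasurableSet {x : ι → ℝ | ∀ k ∈ s, x k = 0} := by
        have : {x : ι → ℝ | ∀ k ∈ s, x k = 0} = ⋂ k ∈ s, {x : ι → ℝ | x k = 0} := by
          ext x; simp
        rw [this]
        exact Finset.measurableSet_biInter _ fun k _ =>
          measurable_pi_apply k (measurableSet_singleton 0)
      have hgm : Measurable g := hf.indicator hms
      have f0 : f 0 = 0 := by simpa using hh 0 0
      have hgh : ∀ (c : ℝ) (x : ι → ℝ), g (c • x) = ENNReal.ofReal |c| * g x := by
        intro c x
        by_cases hc : c = 0
        · simp [hc, hg, Set.indicator, f0]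
        · simp [hg, Set.indicator, hc, hh]
      have hdec : {x : ι → ℝ | ∃ k ∈ insert i s, x k ≠ 0}.indicator f
          = fun x => {x : ι → ℝ | x i ≠ 0}.indicator g x
            + {x : ι → ℝ | ∃ k ∈ s, x k ≠ 0}.indicator f x := by
        ext x
        by_cases h1 : x i = 0 <;> by_cases h2 : ∃ k ∈ s, x k ≠ 0
        · simp [Set.indicator, h1]
        · simp [Set.indicator, h1]
        · have h3 : ¬ ∀ k ∈ s, x k = 0 := by push Not; exact h2
          simp [Set.indicator, h1, h2, hg, h3]
        · have h3 : ∀ k ∈ s, x k = 0 := by push Not at h2; exact h2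
          simp only [Set.indicator, hg, Set.mem_ofPred_eq, if_pos h3, if_neg h2, ne_eq, h1,
            not_false_eq_true, if_true, add_zero]
          exact if_pos ⟨i, Finset.mem_insert_self _ _, h1⟩
      have hmi : Measurable ({x : ι → ℝ | x i ≠ 0}.indicator g) :=
        hgm.indicator (measurable_pi_apply i (measurableSet_singleton 0).compl)
      have hmi' : ∀ Z : ι → Ω → ℝ, (∀ j, Measurable (Z j)) →
          Measurable fun ω => {x : ι → ℝ | x i ≠ 0}.indicator g fun j => Z j ω := fun Z hZ =>
        hmi.comp (measurable_pi_lambda (fun ω j => Z j ω) hZ)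
      simp only [hdec]
      rw [lintegral_add_left (hmi' X hmX), lintegral_add_left (hmi' Y hmY), ih,
        lintegral_eq_lintegral_ratioLaw hmX hgm hgh, lintegral_eq_lintegral_ratioLaw hmY hgm hgh,
        ratioLaw_eq_of_zonoidEquivalent hmX hmY h]
  have hall : {x : ι → ℝ | ∃ i ∈ Finset.univ, x i ≠ 0}.indicator f = f := by
    ext x
    by_cases hx : x = 0
    · have f0 : f 0 = 0 := by simpa using hh 0 0
      simp [hx, f0]
    · have := Function.ne_iff.1 hx
      simp only [Pi.zero_apply] at this
      simp [Set.indicator, this]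
  have := key Finset.univ
  rwa [hall] at this

end Ratio

/-! ### Normalized norms -/

/-- The normalized `p`-norm of a vector. -/
noncomputable def vecNorm (p : ℝ≥0∞) {n : ℕ} (x : Fin n → ℝ) : ℝ≥0∞ :=
  if p = ∞ then ⨆ j, ENNReal.ofReal |x j|
  else ((n : ℝ≥0∞)⁻¹ * ∑ j, ENNReal.ofReal |x j| ^ p.toReal) ^ (1 / p.toReal)

theorem meanNorm_eq_vecNorm (p : ℝ≥0∞) (n : ℕ) (x : ℕ → ℝ) :
    meanNorm p n x = vecNorm p fun j : Fin n => x j := by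
  unfold meanNorm vecNorm
  split_ifs with h
  · refine le_antisymm (iSup₂_le fun j hj => ?_) (iSup_le fun j => ?_)
    · exact le_iSup (fun j : Fin n => ENNReal.ofReal |x j|) ⟨j, Finset.mem_range.1 hj⟩
    · exact le_iSup₂_of_le (j : ℕ) (Finset.mem_range.2 j.2) le_rfl
  · rw [Finset.sum_range]

theorem toReal_pos_of_one_le {p : ℝ≥0∞} (hp : 1 ≤ p) (h : p ≠ ∞) : 0 < p.toReal :=
  ENNReal.toReal_pos (zero_lt_one.trans_le hp).ne' h

theorem vecNorm_smul {p : ℝ≥0∞} (hp : 1 ≤ p) {n : ℕ} (c : ℝ) (x : Fin n → ℝ) :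
    vecNorm p (c • x) = ENNReal.ofReal |c| * vecNorm p x := by
  unfold vecNorm
  have h1 : ∀ j, ENNReal.ofReal |(c • x) j| = ENNReal.ofReal |c| * ENNReal.ofReal |x j| := by
    intro j
    rw [Pi.smul_apply, smul_eq_mul, abs_mul, ENNReal.ofReal_mul (abs_nonneg _)]
  simp only [h1]
  split_ifs with h
  · rw [ENNReal.mul_iSup]
  · have hq := toReal_pos_of_one_le hp h
    simp_rw [ENNReal.mul_rpow_of_nonneg _ _ hq.le]
    rw [← Finset.mul_sum, mul_left_comm, ENNReal.mul_rpow_of_nonneg _ _ (by positivity),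
      ← ENNReal.rpow_mul, mul_one_div_cancel hq.ne', ENNReal.rpow_one]

theorem vecNorm_perm (p : ℝ≥0∞) {n : ℕ} (x : Fin n → ℝ) (π : Equiv.Perm (Fin n)) :
    vecNorm p (fun j => x (π j)) = vecNorm p x := by
  unfold vecNorm
  rw [Equiv.sum_comp π fun j => ENNReal.ofReal |x j| ^ p.toReal,
    Equiv.iSup_comp (g := fun j => ENNReal.ofReal |x j|) π]

@[fun_prop]
theorem measurable_vecNorm (p : ℝ≥0∞) (n : ℕ) :
    Measurable (vecNorm p : (Fin n → ℝ) → ℝ≥0∞) := by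
  unfold vecNorm
  split_ifs
  · exact Measurable.iSup fun j => by fun_prop
  · fun_prop

@[fun_prop]
theorem measurable_meanNorm (p : ℝ≥0∞) (n : ℕ) : Measurable (meanNorm p n) := by
  have : meanNorm p n = fun x => vecNorm p fun j : Fin n => x j :=
    funext fun x => meanNorm_eq_vecNorm p n x
  rw [this]
  exact (measurable_vecNorm p n).comp (by fun_prop)

@[fun_prop]
theorem measurable_limNorm (p : ℝ≥0∞) : Measurable (limNorm p) :=
  Measurable.limsup fun n => measurable_meanNorm p n

theorem limNorm_neg (p : ℝ≥0∞) (x : ℕ → ℝ) : limNorm p (fun j => -x j) = limNorm p x := by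
  simp [limNorm, meanNorm]

theorem vecNorm_le_sum {p : ℝ≥0∞} (hp : 1 ≤ p) {n : ℕ} (x : Fin n → ℝ) :
    vecNorm p x ≤ ∑ j, ENNReal.ofReal |x j| := by
  have hj : ∀ j, ENNReal.ofReal |x j| ≤ ∑ j, ENNReal.ofReal |x j| := fun j =>
    Finset.single_le_sum (f := fun j => ENNReal.ofReal |x j|) (fun _ _ => zero_le)
      (Finset.mem_univ j)
  unfold vecNorm
  split_ifs with h
  · exact iSup_le hj
  · have hq := toReal_pos_of_one_le hp h
    set S := ∑ j, ENNReal.ofReal |x j|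
    calc ((n : ℝ≥0∞)⁻¹ * ∑ j, ENNReal.ofReal |x j| ^ p.toReal) ^ (1 / p.toReal)
        ≤ ((n : ℝ≥0∞)⁻¹ * ∑ j : Fin n, S ^ p.toReal) ^ (1 / p.toReal) := by
          gcongr with j _
          exact hj j
      _ = (((n : ℝ≥0∞)⁻¹ * n) * S ^ p.toReal) ^ (1 / p.toReal) := by simp [mul_assoc]
      _ ≤ (1 * S ^ p.toReal) ^ (1 / p.toReal) := by
          gcongr
          exact ENNReal.inv_mul_le_one _
      _ = S := by rw [one_mul, ← ENNReal.rpow_mul, mul_one_div_cancel hq.ne', ENNReal.rpow_one]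

/-- The power mean inequality; it will control `ξ` on the event that the limit norm vanishes. -/
theorem average_le_vecNorm {p : ℝ≥0∞} (hp : 1 ≤ p) {n : ℕ} (hn : n ≠ 0) (x : Fin n → ℝ) :
    (n : ℝ≥0∞)⁻¹ * ∑ j, ENNReal.ofReal |x j| ≤ vecNorm p x := by
  have hn1 : (n : ℝ≥0∞)⁻¹ * n = 1 :=
    ENNReal.inv_mul_cancel (by exact_mod_cast hn) (ENNReal.natCast_ne_top n)
  unfold vecNorm
  split_ifs with h
  · calc _ ≤ (n : ℝ≥0∞)⁻¹ * ∑ _j : Fin n, ⨆ j, ENNReal.ofReal |x j| := by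
          gcongr with j _
          exact le_iSup (fun j => ENNReal.ofReal |x j|) j
      _ = ⨆ j, ENNReal.ofReal |x j| := by simp [← mul_assoc, hn1]
  · have hq := toReal_pos_of_one_le hp h
    have h1 : 1 ≤ p.toReal := by simpa using ENNReal.toReal_mono h hp
    have := ENNReal.rpow_arith_mean_le_arith_mean_rpow Finset.univ
      (fun _ : Fin n => (n : ℝ≥0∞)⁻¹) (fun j => ENNReal.ofReal |x j|)
      (by simpa [mul_comm] using hn1) h1
    rw [← Finset.mul_sum, ← Finset.mul_sum] at this
    calc _ = (((n : ℝ≥0∞)⁻¹ * ∑ j, ENNReal.ofReal |x j|) ^ p.toReal) ^ (1 / p.toReal) := by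
          rw [← ENNReal.rpow_mul, mul_one_div_cancel hq.ne', ENNReal.rpow_one]
      _ ≤ _ := by gcongr

/-! ### Permutation invariance at finite `n` and passage to the limit -/

section

variable {Ω : Type*} [MeasurableSpace Ω]

theorem lintegral_mul_meanNorm_perm {P : Measure Ω} {p : ℝ≥0∞} (hp : 1 ≤ p) {ξ : ℕ → Ω → ℝ}
    (hm : ∀ j, Measurable (ξ j)) (hswap : SwapInvariant ξ P) {m : ℕ} {F : (Fin m → ℝ) → ℝ≥0∞}
    (hF : Measurable F) (heven : ∀ x, F (-x) = F x) (k : Fin m ↪ ℕ) (σ : Equiv.Perm (Fin m))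
    {n : ℕ} (hn : ∀ i, k i < n) :
    ∫⁻ ω, F ((meanNorm p n fun j => ξ j ω).toReal⁻¹ • fun i => ξ (k (σ i)) ω)
        * meanNorm p n (fun j => ξ j ω) ∂P =
      ∫⁻ ω, F ((meanNorm p n fun j => ξ j ω).toReal⁻¹ • fun i => ξ (k i) ω)
        * meanNorm p n (fun j => ξ j ω) ∂P := by
  let e : Fin m ↪ Fin n := ⟨fun i => ⟨k i, hn i⟩, fun i j h => k.injective (by simpa using h)⟩
  -- `π` acts as `σ` on the selected indices and fixes all others.
  let π : Equiv.Perm (Fin n) := σ.viaEmbedding e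
  let f : (Fin n → ℝ) → ℝ≥0∞ := fun x =>
    F ((vecNorm p x).toReal⁻¹ • fun i => x (e i)) * vecNorm p x
  have hf : Measurable f :=
    (hF.comp (((measurable_vecNorm p n).ennreal_toReal.inv).smul (by fun_prop))).mul
      (measurable_vecNorm p n)
  have hh : ∀ (c : ℝ) (x : Fin n → ℝ), f (c • x) = ENNReal.ofReal |c| * f x := by
    intro c x
    simp only [f]
    rw [vecNorm_smul hp]
    by_cases hc : c = 0
    · simp [hc]
    · have : F ((ENNReal.ofReal |c| * vecNorm p x).toReal⁻¹ • fun i => (c • x) (e i))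
          = F ((vecNorm p x).toReal⁻¹ • fun i => x (e i)) := by
        rw [ENNReal.toReal_mul, ENNReal.toReal_ofReal (abs_nonneg c)]
        rcases abs_cases c with ⟨h, -⟩ | ⟨h, -⟩
        · rw [h]
          congr 1
          ext i
          simp only [Pi.smul_apply, smul_eq_mul, mul_inv]
          field_simp
        · rw [h, ← heven]
          congr 1
          ext i
          simp only [Pi.smul_apply, Pi.neg_apply, smul_eq_mul, mul_inv, inv_neg]
          field_simp
      rw [this]
      ring
  have key := lintegral_eq_of_zonoidEquivalent (fun i => hm _) (fun i => hm _)
    (hswap n ⟨fun i : Fin n => (i : ℕ), Fin.val_injective⟩ π) hf hh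
  simp only [f, Function.Embedding.coeFn_mk, π, Equiv.Perm.viaEmbedding_apply] at key
  have hperm : ∀ ω, vecNorm p (fun j => ξ (σ.viaEmbedding e j : Fin n) ω)
      = vecNorm p fun j : Fin n => ξ j ω :=
    fun ω => vecNorm_perm p (fun j : Fin n => ξ j ω) _
  simp_rw [hperm] at key
  simp_rw [meanNorm_eq_vecNorm]
  exact key

theorem enorm_toReal_sub_le {a b : ℝ≥0∞} (ha : a ≠ ∞) (hb : b ≠ ∞) :
    ‖a.toReal - b.toReal‖ₑ ≤ absDiff a b := by
  rw [Real.enorm_eq_ofReal_abs, absDiff]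
  rcases le_total a b with h | h
  · rw [abs_of_nonpos (sub_nonpos.2 (ENNReal.toReal_mono hb h)), neg_sub,
      ← ENNReal.toReal_sub_of_le h hb]
    exact ENNReal.ofReal_toReal_le.trans le_add_self
  · rw [abs_of_nonneg (sub_nonneg.2 (ENNReal.toReal_mono ha h)),
      ← ENNReal.toReal_sub_of_le h ha]
    exact ENNReal.ofReal_toReal_le.trans le_self_add

/-- The difference splits as `h(V/N) (N - L) + (h(V/N) - h(V/L)) L`: the first term is at most `C |N
- L|`, the second is dominated by `C L`. -/
theorem tendsto_lintegral_mul_of_tendsto_absDiff {P : Measure Ω} {N : ℕ → Ω → ℝ≥0∞}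
    {L : Ω → ℝ≥0∞} (hN : ∀ n, Measurable (N n)) (hL : Measurable L)
    (hNi : ∀ n, ∫⁻ ω, N n ω ∂P ≠ ∞) (hLi : ∫⁻ ω, L ω ∂P ≠ ∞)
    (has : ∀ᵐ ω ∂P, Tendsto (fun n => N n ω) atTop (𝓝 (L ω)))
    (hL1 : Tendsto (fun n => ∫⁻ ω, absDiff (N n ω) (L ω) ∂P) atTop (𝓝 0))
    {m : ℕ} {h : (Fin m → ℝ) → NNReal} (hc : Continuous h) {C : NNReal} (hC : ∀ x, h x ≤ C)
    {V : Ω → Fin m → ℝ} (hV : Measurable V) :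
    Tendsto (fun n => ∫⁻ ω, (h ((N n ω).toReal⁻¹ • V ω) : ℝ≥0∞) * N n ω ∂P) atTop
      (𝓝 (∫⁻ ω, (h ((L ω).toReal⁻¹ • V ω) : ℝ≥0∞) * L ω ∂P)) := by
  have hmeas : ∀ M : Ω → ℝ≥0∞, Measurable M →
      Measurable fun ω => h ((M ω).toReal⁻¹ • V ω) := fun M hM =>
    hc.measurable.comp (hM.ennreal_toReal.inv.smul hV)
  have hfin : ∀ M : Ω → ℝ≥0∞, Measurable M → ∫⁻ ω, M ω ∂P ≠ ∞ → ∀ᵐ ω ∂P, M ω ≠ ∞ :=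
    fun M hM hi => (ae_lt_top hM hi).mono fun ω h => h.ne
  have hint : ∀ M : Ω → ℝ≥0∞, Measurable M → ∫⁻ ω, M ω ∂P ≠ ∞ →
      Integrable (fun ω => (h ((M ω).toReal⁻¹ • V ω) : ℝ) * (M ω).toReal) P := by
    intro M hM hi
    refine ((integrable_toReal_of_lintegral_ne_top hM.aemeasurable hi).const_mul (C : ℝ)).mono'
      ((hmeas M hM).coe_nnreal_real.mul hM.ennreal_toReal).aestronglyMeasurable
      (Eventually.of_forall fun ω => ?_)
    rw [Real.norm_of_nonneg (by positivity)]
    gcongr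
    exact_mod_cast hC _
  have hconv : ∀ M : Ω → ℝ≥0∞, Measurable M → ∫⁻ ω, M ω ∂P ≠ ∞ →
      ∫⁻ ω, (h ((M ω).toReal⁻¹ • V ω) : ℝ≥0∞) * M ω ∂P
        = ENNReal.ofReal (∫ ω, (h ((M ω).toReal⁻¹ • V ω) : ℝ) * (M ω).toReal ∂P) := by
    intro M hM hi
    rw [ofReal_integral_eq_lintegral_ofReal (hint M hM hi)
      (Eventually.of_forall fun ω => by positivity)]
    refine lintegral_congr_ae ((hfin M hM hi).mono fun ω hω => ?_)
    simp only
    rw [ENNReal.ofReal_mul (by positivity), ENNReal.ofReal_toReal hω, ENNReal.ofReal_coe_nnreal]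
  rw [hconv L hL hLi]
  simp_rw [fun n => hconv (N n) (hN n) (hNi n)]
  refine (ENNReal.continuous_ofReal.tendsto _).comp
    (tendsto_integral_of_L1 _ (hint L hL hLi).aestronglyMeasurable
      (Eventually.of_forall fun n => hint (N n) (hN n) (hNi n)) ?_)
  have hD : Tendsto (fun n => ∫⁻ ω, ‖(h ((N n ω).toReal⁻¹ • V ω) : ℝ)
      - (h ((L ω).toReal⁻¹ • V ω) : ℝ)‖ₑ * L ω ∂P) atTop (𝓝 0) := by
    rw [← lintegral_zero (μ := P)]
    refine tendsto_lintegral_of_dominated_convergence (fun ω => (C : ℝ≥0∞) * L ω) ?_ ?_ ?_ ?_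
    · intro n
      exact (((hmeas _ (hN n)).coe_nnreal_real.sub
        (hmeas _ hL).coe_nnreal_real).enorm).mul hL
    · intro n
      refine Eventually.of_forall fun ω => ?_
      simp only
      gcongr
      rw [Real.enorm_eq_ofReal_abs]
      refine ENNReal.ofReal_le_of_le_toReal ?_
      rw [ENNReal.coe_toReal, abs_le]
      have h1 : (h ((N n ω).toReal⁻¹ • V ω) : ℝ) ≤ C := by exact_mod_cast hC _
      have h2 : (h ((L ω).toReal⁻¹ • V ω) : ℝ) ≤ C := by exact_mod_cast hC _
      have h3 := (h ((N n ω).toReal⁻¹ • V ω)).coe_nonneg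
      have h4 := (h ((L ω).toReal⁻¹ • V ω)).coe_nonneg
      constructor <;> linarith
    · rw [lintegral_const_mul _ hL]
      exact ENNReal.mul_ne_top ENNReal.coe_ne_top hLi
    · filter_upwards [has, hfin L hL hLi] with ω h1 h2
      -- Where `L = 0` the vectors `V / N` need not converge, but the factor `L` removes this event.
      by_cases h0 : L ω = 0
      · simp [h0]
      have hr : Tendsto (fun n => (N n ω).toReal⁻¹ • V ω) atTop (𝓝 ((L ω).toReal⁻¹ • V ω)) :=
        (((ENNReal.tendsto_toReal h2).comp h1).inv₀
          (ENNReal.toReal_ne_zero.2 ⟨h0, h2⟩)).smul_const _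
      have hs : Tendsto (fun n => (h ((N n ω).toReal⁻¹ • V ω) : ℝ)
          - (h ((L ω).toReal⁻¹ • V ω) : ℝ)) atTop (𝓝 0) := by
        rw [← sub_self (h ((L ω).toReal⁻¹ • V ω) : ℝ)]
        exact ((NNReal.continuous_coe.comp hc).tendsto _ |>.comp hr).sub_const _
      have := ENNReal.Tendsto.mul_const (b := L ω) (hs.enorm) (Or.inr h2)
      simpa using this
  have hB := (ENNReal.Tendsto.const_mul (a := (C : ℝ≥0∞)) hL1
    (Or.inr ENNReal.coe_ne_top)).add hD
  rw [mul_zero, add_zero] at hB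
  refine tendsto_of_tendsto_of_tendsto_of_le_of_le tendsto_const_nhds hB
    (fun _ => zero_le) fun n => ?_
  simp only
  have hma : Measurable fun ω => absDiff (N n ω) (L ω) :=
    ((hN n).sub hL).add (hL.sub (hN n))
  rw [← lintegral_const_mul _ hma, ← lintegral_add_left (hma.const_mul _)]
  refine lintegral_mono_ae ?_
  filter_upwards [hfin _ (hN n) (hNi n), hfin L hL hLi] with ω h1 h2
  set a := h ((N n ω).toReal⁻¹ • V ω) with ha
  set b := h ((L ω).toReal⁻¹ • V ω)
  have hdec : (a : ℝ) * (N n ω).toReal - b * (L ω).toReal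
      = a * ((N n ω).toReal - (L ω).toReal) + (a - b) * (L ω).toReal := by ring
  rw [hdec]
  refine (enorm_add_le _ _).trans (add_le_add ?_ ?_)
  · rw [enorm_mul]
    refine mul_le_mul' ?_ (enorm_toReal_sub_le h1 h2)
    rw [Real.enorm_eq_ofReal_abs, abs_of_nonneg a.coe_nonneg, ENNReal.ofReal_coe_nnreal]
    exact_mod_cast hC _
  · rw [enorm_mul]
    gcongr
    rw [Real.enorm_eq_ofReal_abs, abs_of_nonneg ENNReal.toReal_nonneg]
    exact ENNReal.ofReal_toReal_le

end

/-! ### Exchangeability under the tilted measure -/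

section

variable {Ω : Type*} [MeasurableSpace Ω]

/-- A swap-invariant sequence whose normalized `p`-norms converge almost surely and in mean to a
limit that does not vanish almost surely. -/
structure NormConvergent (p : ℝ≥0∞) (ξ : ℕ → Ω → ℝ) (P : Measure Ω) : Prop where
  one_le : 1 ≤ p
  measurable : ∀ j, Measurable (ξ j)
  swapInvariant : SwapInvariant ξ P
  tendsto_ae : ∀ᵐ ω ∂P, Tendsto (fun n => meanNorm p n (fun j => ξ j ω)) atTop
    (𝓝 (limNorm p (fun j => ξ j ω)))
  tendsto_mean : Tendsto (fun n => ∫⁻ ω, absDiff (meanNorm p n (fun j => ξ j ω))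
    (limNorm p (fun j => ξ j ω)) ∂P) atTop (𝓝 0)
  pos : 0 < ∫⁻ ω, limNorm p (fun j => ξ j ω) ∂P

namespace NormConvergent

variable {P : Measure Ω} {p : ℝ≥0∞} {ξ : ℕ → Ω → ℝ} (h : NormConvergent p ξ P)

include h

theorem measurable_path : Measurable fun ω j => ξ j ω :=
  measurable_pi_lambda _ h.measurable

theorem measurable_mean (n : ℕ) : Measurable fun ω => meanNorm p n fun j => ξ j ω :=
  (measurable_meanNorm p n).comp h.measurable_path

theorem measurable_lim : Measurable fun ω => limNorm p fun j => ξ j ω :=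
  (measurable_limNorm p).comp h.measurable_path

theorem integrable (j : ℕ) : Integrable (ξ j) P :=
  (h.swapInvariant 1 ⟨fun _ => j, Function.injective_of_subsingleton _⟩ 1).integrable_right 0

theorem lintegral_ofReal_abs_ne_top (j : ℕ) : ∫⁻ ω, ENNReal.ofReal |ξ j ω| ∂P ≠ ∞ := by
  have := (h.integrable j).hasFiniteIntegral.ne
  simpa [Real.enorm_eq_ofReal_abs] using this

theorem lintegral_mean_ne_top (n : ℕ) : ∫⁻ ω, meanNorm p n (fun j => ξ j ω) ∂P ≠ ∞ := by
  have hm := h.measurable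
  refine ne_top_of_le_ne_top ?_ (lintegral_mono fun ω => (meanNorm_eq_vecNorm p n _).trans_le
    (vecNorm_le_sum h.one_le _))
  rw [lintegral_finsetSum _ fun j _ => by fun_prop]
  exact ENNReal.sum_ne_top.2 fun j _ => h.lintegral_ofReal_abs_ne_top j

/-- `L ≤ N + |N - L|`, and both terms have finite mean for some `n`. -/
theorem lintegral_lim_ne_top : ∫⁻ ω, limNorm p (fun j => ξ j ω) ∂P ≠ ∞ := by
  obtain ⟨n, hn⟩ := (h.tendsto_mean.eventually (gt_mem_nhds zero_lt_one)).exists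
  refine ne_top_of_le_ne_top (ENNReal.add_ne_top.2 ⟨h.lintegral_mean_ne_top n, hn.ne_top⟩) ?_
  rw [← lintegral_add_left (h.measurable_mean n)]
  refine lintegral_mono fun ω => ?_
  exact le_add_tsub.trans (add_le_add le_rfl le_add_self)

theorem lim_ne_top : ∀ᵐ ω ∂P, limNorm p (fun j => ξ j ω) ≠ ∞ :=
  (ae_lt_top h.measurable_lim h.lintegral_lim_ne_top).mono fun _ hω => hω.ne

theorem isProbabilityMeasure : IsProbabilityMeasure (normTilted p ξ P) := by
  refine ⟨?_⟩
  rw [normTilted, withDensity_apply _ .univ, Measure.restrict_univ]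
  simp_rw [div_eq_mul_inv]
  rw [lintegral_mul_const _ h.measurable_lim, ENNReal.mul_inv_cancel h.pos.ne'
    h.lintegral_lim_ne_top]

theorem lintegral_normTilted {f : Ω → ℝ≥0∞} (hf : Measurable f) :
    ∫⁻ ω, f ω ∂(normTilted p ξ P) = (∫⁻ ω, limNorm p (fun j => ξ j ω) ∂P)⁻¹ *
      ∫⁻ ω, f ω * limNorm p (fun j => ξ j ω) ∂P := by
  rw [normTilted, lintegral_withDensity_eq_lintegral_mul _ (h.measurable_lim.div_const _) hf,
    ← lintegral_const_mul _ (show Measurable fun ω => f ω * limNorm p (fun j => ξ j ω) from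
      hf.mul h.measurable_lim)]
  refine lintegral_congr fun ω => ?_
  simp only [Pi.mul_apply, div_eq_mul_inv]
  ring

theorem lintegral_even_mul_lim_perm {m : ℕ} {g : (Fin m → ℝ) → NNReal} (hc : Continuous g)
    {C : NNReal} (hC : ∀ x, g x ≤ C) (heven : ∀ x, g (-x) = g x) (k : Fin m ↪ ℕ)
    (σ : Equiv.Perm (Fin m)) :
    ∫⁻ ω, (g ((limNorm p fun j => ξ j ω).toReal⁻¹ • fun i => ξ (k (σ i)) ω) : ℝ≥0∞)
        * limNorm p (fun j => ξ j ω) ∂P =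
      ∫⁻ ω, (g ((limNorm p fun j => ξ j ω).toReal⁻¹ • fun i => ξ (k i) ω) : ℝ≥0∞)
        * limNorm p (fun j => ξ j ω) ∂P := by
  have key : ∀ τ : Fin m → ℕ, _ := fun τ =>
    tendsto_lintegral_mul_of_tendsto_absDiff h.measurable_mean h.measurable_lim
      h.lintegral_mean_ne_top h.lintegral_lim_ne_top h.tendsto_ae h.tendsto_mean hc hC
      (measurable_pi_lambda (fun ω i => ξ (τ i) ω) fun i => h.measurable (τ i))
  refine tendsto_nhds_unique (key fun i => k (σ i)) ((key k).congr' ?_)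
  -- Once `n` exceeds every selected index, the two means agree exactly.
  filter_upwards [eventually_gt_atTop (Finset.univ.sup k)] with n hn
  exact (lintegral_mul_meanNorm_perm h.one_le h.measurable h.swapInvariant
    (F := fun x => (g x : ℝ≥0∞)) hc.measurable.coe_nnreal_ennreal
    (fun x => by simp only [heven]) k σ fun i =>
      (Finset.le_sup (f := k) (Finset.mem_univ i)).trans_lt hn).symm

/-- A sequence is exchangeable under the tilted measure as soon as the means of its bounded
continuous functions are those of even functions of the normalized sequence. -/
theorem exchangeable_of_even {ζ : ℕ → Ω → ℝ} (hζ : ∀ j, Measurable (ζ j))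
    (H : ∀ (m : ℕ) (g : BoundedContinuousFunction (Fin m → ℝ) NNReal),
      ∃ (g' : (Fin m → ℝ) → NNReal) (C : NNReal), Continuous g' ∧ (∀ x, g' x ≤ C) ∧
        (∀ x, g' (-x) = g' x) ∧ ∀ k : Fin m ↪ ℕ,
          2 * ∫⁻ ω, (g fun i => ζ (k i) ω : ℝ≥0∞) * limNorm p (fun j => ξ j ω) ∂P =
            ∫⁻ ω, (g' ((limNorm p fun j => ξ j ω).toReal⁻¹ • fun i => ξ (k i) ω) : ℝ≥0∞)
              * limNorm p (fun j => ξ j ω) ∂P) :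
    Exchangeable ζ (normTilted p ξ P) := by
  intro m k σ
  have hQ := h.isProbabilityMeasure
  have hm : ∀ τ : Fin m → ℕ, Measurable fun ω i => ζ (τ i) ω := fun τ =>
    measurable_pi_lambda _ fun i => hζ _
  have hp := fun τ : Fin m → ℕ => Measure.isProbabilityMeasure_map
    (μ := normTilted p ξ P) (hm τ).aemeasurable
  have hp1 := hp k
  have hp2 := hp fun i => k (σ i)
  refine ⟨(hm fun i => k (σ i)).aemeasurable, (hm k).aemeasurable, ?_⟩
  refine ext_of_forall_lintegral_eq_of_IsFiniteMeasure fun g => ?_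
  have hg : Measurable fun x => (g x : ℝ≥0∞) := g.continuous.measurable.coe_nnreal_ennreal
  rw [lintegral_map hg (hm fun i => k (σ i)), lintegral_map hg (hm k),
    h.lintegral_normTilted (f := fun ω => (g fun i => ζ (k (σ i)) ω : ℝ≥0∞))
      (hg.comp (hm fun i => k (σ i))),
    h.lintegral_normTilted (f := fun ω => (g fun i => ζ (k i) ω : ℝ≥0∞)) (hg.comp (hm k))]
  congr 1
  obtain ⟨g', C, hc, hC, heven, hk⟩ := H m g
  have h1 := hk k
  have h2 := hk (σ.toEmbedding.trans k)
  simp only [Function.Embedding.trans_apply, Equiv.coe_toEmbedding] at h2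
  rw [h.lintegral_even_mul_lim_perm hc hC heven, ← h1] at h2
  -- The factor `2` in `H` allows `g(x) + g(-x)` without halving; here it cancels.
  exact (ENNReal.mul_right_inj two_ne_zero ENNReal.ofNat_ne_top).1 h2

theorem measurable_ratio (j : ℕ) :
    Measurable fun ω => (limNorm p fun i => ξ i ω).toReal⁻¹ * ξ j ω :=
  h.measurable_lim.ennreal_toReal.inv.mul (h.measurable j)

/-- The function `g(|x|)`, absolute values taken coordinatewise, is even. -/
theorem exchangeable_of_eq_abs {ζ : ℕ → Ω → ℝ} (hζ : ∀ j, Measurable (ζ j))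
    (he : ∀ j, ∀ᵐ ω ∂P, ζ j ω = |(limNorm p fun i => ξ i ω).toReal⁻¹ * ξ j ω|) :
    Exchangeable ζ (normTilted p ξ P) := by
  refine h.exchangeable_of_even hζ fun m g => ?_
  obtain ⟨C, hC⟩ : ∃ C : NNReal, ∀ x, g x ≤ C := ⟨_, BoundedContinuousFunction.NNReal.upper_bound g⟩
  refine ⟨fun x => 2 * g fun i => |x i|, 2 * C, by fun_prop, fun x => mul_le_mul_right (hC _) _,
    fun x => by simp, fun k => ?_⟩
  have hma : Measurable fun ω => (g fun i => ζ (k i) ω : ℝ≥0∞) * limNorm p (fun j => ξ j ω) :=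
    ((g.continuous.measurable.comp (measurable_pi_lambda (fun ω i => ζ (k i) ω)
      fun i => hζ _)).coe_nnreal_ennreal).mul h.measurable_lim
  rw [← lintegral_const_mul _ hma]
  refine lintegral_congr_ae ?_
  filter_upwards [ae_all_iff.2 he] with ω hω
  simp only [hω, Pi.smul_apply, smul_eq_mul]
  push_cast
  ring

theorem exchangeable_of_symmetrized {ζ : ℕ → Ω → ℝ} (hζ : ∀ j, Measurable (ζ j))
    (H : ∀ (m : ℕ) (g : BoundedContinuousFunction (Fin m → ℝ) NNReal) (k : Fin m ↪ ℕ),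
      2 * ∫⁻ ω, (g fun i => ζ (k i) ω : ℝ≥0∞) * limNorm p (fun j => ξ j ω) ∂P =
        ∫⁻ ω, (g ((limNorm p fun j => ξ j ω).toReal⁻¹ • fun i => ξ (k i) ω) : ℝ≥0∞)
          * limNorm p (fun j => ξ j ω) ∂P +
        ∫⁻ ω, (g (-((limNorm p fun j => ξ j ω).toReal⁻¹ • fun i => ξ (k i) ω)) : ℝ≥0∞)
          * limNorm p (fun j => ξ j ω) ∂P) :
    Exchangeable ζ (normTilted p ξ P) := by
  refine h.exchangeable_of_even hζ fun m g => ?_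
  obtain ⟨C, hC⟩ : ∃ C : NNReal, ∀ x, g x ≤ C := ⟨_, BoundedContinuousFunction.NNReal.upper_bound g⟩
  refine ⟨fun x => g x + g (-x), C + C, by fun_prop, fun x => add_le_add (hC _) (hC _),
    fun x => by simp only [neg_neg, add_comm], fun k => ?_⟩
  rw [H m g k, ← lintegral_add_left]
  · refine lintegral_congr fun ω => ?_
    push_cast
    ring
  · exact ((g.continuous.measurable.comp (h.measurable_lim.ennreal_toReal.inv.smul
      (measurable_pi_lambda (fun ω i => ξ (k i) ω) fun i => h.measurable _))).coe_nnreal_ennreal).mul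
      h.measurable_lim

end NormConvergent

/-- A function of the normalized coordinates of a path, weighted by the norm of the path. -/
theorem measurable_weighted_normalized (p : ℝ≥0∞) {m : ℕ} {g : (Fin m → ℝ) → NNReal}
    (hg : Continuous g) (k : Fin m → ℕ) :
    Measurable fun x : ℕ → ℝ =>
      (g ((limNorm p x).toReal⁻¹ • fun i => x (k i)) : ℝ≥0∞) * limNorm p x := by
  have hL := measurable_limNorm p
  exact ((hg.measurable.comp (hL.ennreal_toReal.inv.smul
    (by fun_prop))).coe_nnreal_ennreal).mul hL

namespace NormConvergent

variable {P : Measure Ω} {p : ℝ≥0∞} {ξ : ℕ → Ω → ℝ} (h : NormConvergent p ξ P)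

include h

/-- The limit norm is even, so symmetry equates the weighted means of `g(x)` and `g(-x)`. -/
theorem exchangeable_of_symmetric (hs : SymmetricSequence ξ P) :
    Exchangeable (fun j ω => (limNorm p fun i => ξ i ω).toReal⁻¹ * ξ j ω)
      (normTilted p ξ P) := by
  refine h.exchangeable_of_symmetrized h.measurable_ratio fun m g k => ?_
  have h1 := (hs.comp (measurable_weighted_normalized p g.continuous k)).lintegral_eq
  simp only [Function.comp_def, limNorm_neg] at h1
  have h2 : ∀ ω, (-((limNorm p fun j => ξ j ω).toReal⁻¹ • fun i => ξ (k i) ω) : Fin m → ℝ)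
      = (limNorm p fun j => ξ j ω).toReal⁻¹ • fun i => -ξ (k i) ω := by
    intro ω
    ext i
    simp
  simp_rw [h2]
  rw [h1, two_mul]
  rfl

theorem exchangeable_mul_sign [IsProbabilityMeasure P] {ε : Ω → ℝ} (hε : Measurable ε)
    (h1 : P {ω | ε ω = 1} = 1 / 2) (h2 : P {ω | ε ω = -1} = 1 / 2)
    (hind : IndepFun ε (fun ω j => ξ j ω) P) :
    Exchangeable (fun j ω => ε ω * ((limNorm p fun i => ξ i ω).toReal⁻¹ * ξ j ω))
      (normTilted p ξ P) := by
  refine h.exchangeable_of_symmetrized (fun j => hε.mul (h.measurable_ratio j)) fun m g k => ?_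
  have hms : ∀ s : ℝ, MeasurableSet {ω | ε ω = s} := fun s => hε (measurableSet_singleton s)
  have hae : ∀ᵐ ω ∂P, ε ω = 1 ∨ ε ω = -1 := by
    have hd : Disjoint {ω | ε ω = 1} {ω | ε ω = -1} := by
      rw [Set.disjoint_left]
      intro ω ha hb
      simp only [Set.mem_ofPred_eq] at ha hb
      linarith
    have hu : P ({ω | ε ω = 1} ∪ {ω | ε ω = -1}) = 1 := by
      rw [measure_union hd (hms _), h1, h2, ENNReal.add_halves]
    exact (prob_compl_eq_zero_iff ((hms _).union (hms _))).2 hu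
  -- The weight `L` is a function of the path `ξ`, so it can be absorbed in `Φ`, and independence
  -- under `P` is enough.
  have hhalf : ∀ (s : ℝ) (Φ : (ℕ → ℝ) → ℝ≥0∞), Measurable Φ → P {ω | ε ω = s} = 1 / 2 →
      2 * ∫⁻ ω, ({s} : Set ℝ).indicator 1 (ε ω) * Φ (fun j => ξ j ω) ∂P
        = ∫⁻ ω, Φ (fun j => ξ j ω) ∂P := by
    intro s Φ hΦ hs
    have hi : Measurable (({s} : Set ℝ).indicator (1 : ℝ → ℝ≥0∞)) :=
      measurable_one.indicator (measurableSet_singleton s)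
    have := lintegral_mul_eq_lintegral_mul_lintegral_of_indepFun (hi.comp hε)
      (hΦ.comp h.measurable_path) (hind.comp hi hΦ)
    simp only [Pi.mul_apply, Function.comp_def] at this
    have he : ∫⁻ ω, ({s} : Set ℝ).indicator (1 : ℝ → ℝ≥0∞) (ε ω) ∂P = 1 / 2 := by
      rw [← hs, ← lintegral_indicator_one (hms s)]
      rfl
    rw [this, he, ← mul_assoc, one_div, ENNReal.mul_inv_cancel two_ne_zero ENNReal.ofNat_ne_top,
      one_mul]
  have hΦ1 := measurable_weighted_normalized p g.continuous k
  have hΦ2 := measurable_weighted_normalized p (g.continuous.comp continuous_neg) k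
  have e1 := hhalf 1 _ hΦ1 h1
  have e2 := hhalf (-1) _ hΦ2 h2
  simp only [Function.comp_def] at e2
  rw [← e1, ← e2, ← mul_add, ← lintegral_add_left]
  · congr 1
    refine lintegral_congr_ae ?_
    filter_upwards [hae] with ω hω
    rcases hω with hω | hω
    · have hne : (1 : ℝ) ≠ -1 := by norm_num
      simp only [hω, one_mul, Set.indicator, Set.mem_singleton_iff, if_true, Pi.one_apply,
        if_neg hne, zero_mul, add_zero]
      rfl
    · have hne : (-1 : ℝ) ≠ 1 := by norm_num
      simp only [hω, one_mul, Set.indicator, Set.mem_singleton_iff, if_true, Pi.one_apply,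
        if_neg hne, zero_mul, zero_add]
      congr 3
      ext i
      simp
  · exact ((measurable_one.indicator (measurableSet_singleton _)).comp hε).mul
      (hΦ1.comp h.measurable_path)

/-! ### Vanishing of the sequence where the limit norm vanishes -/

theorem lintegral_abs_eq (j : ℕ) :
    ∫⁻ ω, ENNReal.ofReal |ξ j ω| ∂P = ∫⁻ ω, ENNReal.ofReal |ξ 0 ω| ∂P := by
  rcases eq_or_ne j 0 with rfl | hj
  · rfl
  have hinj : Function.Injective ![j, 0] := by
    intro a b
    fin_cases a <;> fin_cases b <;> simp [hj, hj.symm]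
  have := (h.swapInvariant 2 ⟨![j, 0], hinj⟩ (Equiv.swap 0 1)).integral_eq ![0, 1]
  simp only [Fin.sum_univ_two] at this
  simp at this
  have e := fun i => ofReal_integral_norm_eq_lintegral_enorm (h.integrable i)
  simp only [Real.norm_eq_abs, Real.enorm_eq_ofReal_abs] at e
  rw [← e, ← e, this]

/-- Each side is `E L` times the `Q`-mean of `|ξ j / L|`, and these absolute ratios are exchangeable
without any sign assumption. -/
theorem lintegral_indicator_abs_eq (j : ℕ) :
    ∫⁻ ω, {ω | limNorm p (fun i => ξ i ω) ≠ 0}.indicator (fun ω => ENNReal.ofReal |ξ j ω|) ω ∂P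
      = ∫⁻ ω, {ω | limNorm p (fun i => ξ i ω) ≠ 0}.indicator
          (fun ω => ENNReal.ofReal |ξ 0 ω|) ω ∂P := by
  rcases eq_or_ne j 0 with rfl | hj
  · rfl
  have hinj : Function.Injective ![j, 0] := by
    intro a b
    fin_cases a <;> fin_cases b <;> simp [hj, hj.symm]
  have hζ : ∀ j, Measurable fun ω => |(limNorm p fun i => ξ i ω).toReal⁻¹ * ξ j ω| :=
    fun j => (h.measurable_ratio j).abs
  have hex := (h.exchangeable_of_eq_abs hζ fun j => Eventually.of_forall fun ω => rfl)
    2 ⟨![j, 0], hinj⟩ (Equiv.swap 0 1)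
  have hid := (hex.comp (u := fun x : Fin 2 → ℝ => ENNReal.ofReal (x 1))
    (by fun_prop)).lintegral_eq
  simp only [Function.comp_def, Equiv.swap_apply_right, Function.Embedding.coeFn_mk] at hid
  rw [h.lintegral_normTilted (hζ _).ennreal_ofReal, h.lintegral_normTilted (hζ _).ennreal_ofReal,
    ENNReal.mul_right_inj (ENNReal.inv_ne_zero.2 h.lintegral_lim_ne_top)
      (ENNReal.inv_ne_top.2 h.pos.ne')] at hid
  have hind : ∀ l, ∫⁻ ω, {ω | limNorm p (fun i => ξ i ω) ≠ 0}.indicator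
      (fun ω => ENNReal.ofReal |ξ l ω|) ω ∂P
      = ∫⁻ ω, ENNReal.ofReal |(limNorm p fun i => ξ i ω).toReal⁻¹ * ξ l ω|
          * limNorm p (fun i => ξ i ω) ∂P := by
    intro l
    refine lintegral_congr_ae ?_
    filter_upwards [h.lim_ne_top] with ω hω
    by_cases h0 : limNorm p (fun i => ξ i ω) = 0
    · simp [h0]
    · simp only [Set.indicator, Set.mem_ofPred_eq, ne_eq, h0, not_false_eq_true, if_true]
      have hpos : 0 < (limNorm p fun i => ξ i ω).toReal := ENNReal.toReal_pos h0 hω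
      conv_rhs => rw [← ENNReal.ofReal_toReal hω, ENNReal.toReal_ofReal hpos.le]
      rw [← ENNReal.ofReal_mul (abs_nonneg _), abs_mul, abs_of_pos (inv_pos.2 hpos)]
      congr 1
      field_simp
  rw [hind, hind]
  simpa using hid

/-- Almost surely, all members of the sequence vanish where the limit norm does. -/
theorem eq_zero_of_lim_eq_zero (j : ℕ) :
    ∀ᵐ ω ∂P, limNorm p (fun i => ξ i ω) = 0 → ξ j ω = 0 := by
  have hm := h.measurable
  set A : Set Ω := {ω | limNorm p (fun i => ξ i ω) ≠ 0} with hA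
  have hAm : MeasurableSet A := h.measurable_lim (measurableSet_singleton 0).compl
  have hsplit : ∀ l, ∫⁻ ω, A.indicator (fun ω => ENNReal.ofReal |ξ l ω|) ω ∂P
      + ∫⁻ ω, Aᶜ.indicator (fun ω => ENNReal.ofReal |ξ l ω|) ω ∂P
      = ∫⁻ ω, ENNReal.ofReal |ξ l ω| ∂P := by
    intro l
    rw [lintegral_indicator hAm, lintegral_indicator hAm.compl, lintegral_add_compl _ hAm]
  have hconst : ∀ l, ∫⁻ ω, Aᶜ.indicator (fun ω => ENNReal.ofReal |ξ l ω|) ω ∂P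
      = ∫⁻ ω, Aᶜ.indicator (fun ω => ENNReal.ofReal |ξ 0 ω|) ω ∂P := by
    intro l
    have h1 := (hsplit l).trans ((h.lintegral_abs_eq l).trans (hsplit 0).symm)
    rw [h.lintegral_indicator_abs_eq l] at h1
    refine (ENNReal.add_right_inj ?_).1 h1
    exact ne_top_of_le_ne_top (h.lintegral_ofReal_abs_ne_top 0)
      (lintegral_mono (Set.indicator_le_self _ _))
  -- Being independent of the index, the mean equals its average over `n` members. On `Aᶜ` that
  -- average is at most `N = |N - L|`.
  have hzero : ∫⁻ ω, Aᶜ.indicator (fun ω => ENNReal.ofReal |ξ 0 ω|) ω ∂P = 0 := by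
    refine le_antisymm (ge_of_tendsto h.tendsto_mean ?_) zero_le
    filter_upwards [eventually_ne_atTop 0] with n hn
    have hn1 : (n : ℝ≥0∞)⁻¹ * n = 1 :=
      ENNReal.inv_mul_cancel (by exact_mod_cast hn) (ENNReal.natCast_ne_top n)
    have hmi : ∀ l, Measurable (Aᶜ.indicator fun ω => ENNReal.ofReal |ξ l ω|) := fun l =>
      (hm l).abs.ennreal_ofReal.indicator hAm.compl
    calc _ = (n : ℝ≥0∞)⁻¹ * ∑ l : Fin n,
          ∫⁻ ω, Aᶜ.indicator (fun ω => ENNReal.ofReal |ξ l ω|) ω ∂P := by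
          simp [hconst, ← mul_assoc, hn1]
      _ = ∫⁻ ω, (n : ℝ≥0∞)⁻¹ * ∑ l : Fin n,
          Aᶜ.indicator (fun ω => ENNReal.ofReal |ξ l ω|) ω ∂P := by
          rw [lintegral_const_mul _ (Finset.measurable_fun_sum _ fun (l : Fin n) _ => hmi l),
            lintegral_finsetSum _ fun (l : Fin n) _ => hmi l]
      _ ≤ _ := by
          refine lintegral_mono fun ω => ?_
          by_cases hω : limNorm p (fun i => ξ i ω) = 0
          · have hc : ω ∈ Aᶜ := by simp [hA, hω]
            simp only [Set.indicator_of_mem hc]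
            refine (average_le_vecNorm h.one_le hn _).trans ?_
            rw [← meanNorm_eq_vecNorm p n fun j => ξ j ω, hω, absDiff]
            simp
          · have hc : ω ∉ Aᶜ := by simp [hA, hω]
            simp [Set.indicator_of_notMem hc]
  have hj := (lintegral_eq_zero_iff
    ((hm j).abs.ennreal_ofReal.indicator hAm.compl)).1 ((hconst j).trans hzero)
  filter_upwards [hj] with ω hω h0
  have hc : ω ∈ Aᶜ := by simp [hA, h0]
  simpa [Set.indicator_of_mem hc] using hω

theorem eq_lim_mul_ratio (j : ℕ) :
    ∀ᵐ ω ∂P, ξ j ω = (limNorm p fun i => ξ i ω).toReal *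
      ((limNorm p fun i => ξ i ω).toReal⁻¹ * ξ j ω) := by
  filter_upwards [h.eq_zero_of_lim_eq_zero j, h.lim_ne_top] with ω h0 hfin
  by_cases hz : limNorm p (fun i => ξ i ω) = 0
  · simp [h0 hz]
  · rw [mul_inv_cancel_left₀ (ENNReal.toReal_ne_zero.2 ⟨hz, hfin⟩)]

end NormConvergent

end

/-! ### The theorem -/

theorem mainTheorem7 {Ω : Type*} [MeasurableSpace Ω] (P : Measure Ω) [IsProbabilityMeasure P]
    (p : ℝ≥0∞) (hp : 1 ≤ p)
    (ξ : ℕ → Ω → ℝ) (hξ_meas : ∀ j, Measurable (ξ j)) (hξ_swap : SwapInvariant ξ P)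
    -- almost sure convergence of the normalized norms
    (h_as : ∀ᵐ ω ∂P, Tendsto (fun n => meanNorm p n (fun j => ξ j ω)) atTop
      (𝓝 (limNorm p (fun j => ξ j ω))))
    -- convergence in mean
    (h_L1 : Tendsto (fun n => ∫⁻ ω, absDiff (meanNorm p n (fun j => ξ j ω))
      (limNorm p (fun j => ξ j ω)) ∂P) atTop (𝓝 0))
    (h_pos : 0 < ∫⁻ ω, limNorm p (fun j => ξ j ω) ∂P) :
    IsProbabilityMeasure (normTilted p ξ P) ∧
    (∀ ε : Ω → ℝ, Measurable ε → P {ω | ε ω = 1} = 1 / 2 → P {ω | ε ω = -1} = 1 / 2 →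
      IndepFun ε (fun ω j => ξ j ω) P →
      ∃ ζ : ℕ → Ω → ℝ, (∀ j, Measurable (ζ j)) ∧ Exchangeable ζ (normTilted p ξ P) ∧
        ∀ j, ∀ᵐ ω ∂P, ε ω * ξ j ω = (limNorm p (fun i => ξ i ω)).toReal * ζ j ω) ∧
    ((SymmetricSequence ξ P ∨ ∀ j, ∀ᵐ ω ∂P, 0 ≤ ξ j ω) →
      ∃ η : ℕ → Ω → ℝ, (∀ j, Measurable (η j)) ∧ Exchangeable η (normTilted p ξ P) ∧
        ∀ j, ∀ᵐ ω ∂P, ξ j ω = (limNorm p (fun i => ξ i ω)).toReal * η j ω) := by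
  have h : NormConvergent p ξ P := ⟨hp, hξ_meas, hξ_swap, h_as, h_L1, h_pos⟩
  refine ⟨h.isProbabilityMeasure, fun ε hε h1 h2 hind => ?_, fun hs => ?_⟩
  -- The witness is `ε ξ / L`, with value `0` where `L = 0`.
  · refine ⟨_, fun j => hε.mul (h.measurable_ratio j), h.exchangeable_mul_sign hε h1 h2 hind,
      fun j => ?_⟩
    filter_upwards [h.eq_lim_mul_ratio j] with ω hω
    rw [Pi.mul_apply, mul_left_comm, ← hω]
  · refine ⟨_, h.measurable_ratio, ?_, h.eq_lim_mul_ratio⟩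
    rcases hs with hs | hs
    · exact h.exchangeable_of_symmetric hs
    · refine h.exchangeable_of_eq_abs h.measurable_ratio fun j => ?_
      filter_upwards [hs j] with ω hω
      exact (abs_of_nonneg (mul_nonneg (inv_nonneg.2 ENNReal.toReal_nonneg) hω)).symm
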